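/- Let $\mathcal F$ be a filter on $\omega$, that is, a family of infinite subsets of $\omega$ which contains all cofinite sets and is closed under finite intersections and under supersets. Identify $\mathcal P(\omega)$ with the Cantor space $2^\omega$ via characteristic functions, and suppose that $\mathcal F$ is an analytic subset of $\mathcal P(\omega)$. Let $\mathbb M_{\mathcal F}$ be the Mathias forcing associated with $\mathcal F$: its conditions are the pairs $\langle s,F\rangle$ with $s\subset\omega$ finite, $F\in\mathcal F$ and $\max s<\min F$, and $\langle s,F\rangle$ is stronger than $\langle t,G\rangle$ if $F\subset G$, $s$ is an end-extension of $t$, and $s\setminus t\subset G$. Then $\mathbb M_{\mathcal F}$ does not add a dominating real if and only if $\mathcal F$ is $\sigma$-compact (as a subspace of $\mathcal P(\omega)$). Here $\mathbb M_{\mathcal F}$ does not add a dominating real if every condition forces that in the generic extension there is no $x\in\omega^\omega$ such that every $a\in\omega^\omega$ of the ground model satisfies $a(n)\le x(n)$ for all but finitely many $n$. -/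

import Mathlib

/-! ## Mathias forcing associated with a filter -/

/-- The conditions `⟨s, A⟩` of the Mathias forcing `𝕄_F`: a finite set `s ⊆ ω` and a set `A ∈ F`
with `max s < min A`. -/
structure MathiasForcing (F : Filter ℕ) where
  stem : Finset ℕ
  side : Set ℕ
  side_mem : side ∈ F
  stem_lt_side : ∀ i ∈ stem, ∀ j ∈ side, i < j

/-- `t` is an initial segment of `s`, that is, `s` is an end-extension of `t`. -/
def IsEndExtension (s t : Finset ℕ) : Prop :=
  t ⊆ s ∧ ∀ i ∈ t, ∀ j ∈ s, j ∉ t → i < j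

/-- `⟨s, A⟩ ≤ ⟨t, B⟩` (`⟨s, A⟩` is stronger than `⟨t, B⟩`) if and only if `A ⊆ B`, `s` is an
end-extension of `t`, and `s \ t ⊆ B`. -/
instance MathiasForcing.instPreorder (F : Filter ℕ) : Preorder (MathiasForcing F) where
  le p q := p.side ⊆ q.side ∧ IsEndExtension p.stem q.stem ∧
    ∀ i ∈ p.stem, i ∉ q.stem → i ∈ q.side
  le_refl p := ⟨subset_rfl, ⟨subset_rfl, fun _ _ _ h h' => absurd h h'⟩,
    fun _ h h' => absurd h h'⟩
  le_trans p q r := by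
    rintro ⟨h1, ⟨h2, h3⟩, h4⟩ ⟨k1, ⟨k2, k3⟩, k4⟩
    refine ⟨h1.trans k1, ⟨k2.trans h2, fun i hi j hj hjr => ?_⟩, fun i hi hir => ?_⟩
    · by_cases hjq : j ∈ q.stem
      · exact k3 i hi j hjq hjr
      · exact h3 i (k2 hi) j hj hjq
    · by_cases hiq : i ∈ q.stem
      · exact k4 i hiq hir
      · exact k1 (h4 i hi hiq)

/-! ## The forcing relation for statements about the reals of the generic extension

`p ≤ q` means that `p` is stronger than `q`. A sentence of the forcing language is represented by
the predicate `p ↦ (p ⊩ φ)`, and the following are the usual recursive clauses of the forcing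
relation. -/

namespace Forcing

/-- Sentences of the forcing language of `P`; `φ p` is read `p ⊩ φ`. -/
abbrev Sentence (P : Type*) := P → Prop

/-- A nice `P`-name for a subset of `ω × ω`: the name
`{⟨(n, m)ˇ, p⟩ : p ∈ τ n m}`. Its value in the generic extension by the generic filter `G` is
`{(n, m) : ∃ p ∈ G, p ∈ τ n m}`. Every subset of `ω × ω` in the generic
extension is the value of such a name. -/
abbrev Name (P : Type*) := ℕ → ℕ → Set P

variable {P : Type*} [Preorder P]

/-- `p ⊩ (n, m)ˇ ∈ τ`: the conditions below some member of `τ n m` are dense below `p`. -/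
def mem (n m : ℕ) (τ : Name P) : Sentence P :=
  fun p => ∀ q ≤ p, ∃ r ≤ q, ∃ s ∈ τ n m, r ≤ s

/-- `p ⊩ φ ∧ ψ`. -/
def and (φ ψ : Sentence P) : Sentence P := fun p => φ p ∧ ψ p

/-- `p ⊩ ¬ φ`: no extension of `p` forces `φ`. -/
def not (φ : Sentence P) : Sentence P := fun p => ∀ q ≤ p, ¬ φ q

/-- `p ⊩ ∀ i, φ i`. -/
def all {ι : Type*} (φ : ι → Sentence P) : Sentence P := fun p => ∀ i, φ i p

/-- `p ⊩ ∃ i, φ i`: the conditions forcing some `φ i` are dense below `p`. -/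
def ex {ι : Type*} (φ : ι → Sentence P) : Sentence P :=
  fun p => ∀ q ≤ p, ∃ r ≤ q, ∃ i, φ i r

/-- `τ` is (the graph of) a function from `ω` to `ω`: for every `n` there is `m` with
`(n, m) ∈ τ`, and there are no `m ≠ m'` with `(n, m) ∈ τ` and `(n, m') ∈ τ`. -/
def isReal (τ : Name P) : Sentence P :=
  and (all fun n : ℕ => ex fun m : ℕ => mem n m τ)
    (all fun n : ℕ => all fun m : ℕ => all fun m' : {m' : ℕ // m ≠ m'} =>
      not (and (mem n m τ) (mem n m' τ)))

/-- `a ≤* τ`, for a ground model function `a`: there is `N` such that for every `n ≥ N` there is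
`m ≥ a n` with `τ n = m`. -/
def dominates (a : ℕ → ℕ) (τ : Name P) : Sentence P :=
  ex fun N : ℕ => all fun n : {n : ℕ // N ≤ n} => ex fun m : {m : ℕ // a n ≤ m} => mem n m τ

/-- There is a dominating real: an `x : ω → ω` such that `a ≤* x` for all ground
model functions `a : ω → ω`. -/
def existsDominatingReal : Sentence P :=
  ex fun τ : Name P => and (isReal τ) (all fun a : ℕ → ℕ => dominates a τ)

/-- `P` does not add a dominating real: every condition forces that the generic
extension has no dominating real. -/
def AddsNoDominatingReal (P : Type*) [Preorder P] : Prop :=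
  ∀ p : P, not existsDominatingReal p

end Forcing

/-! ## Filters as subsets of the Cantor space -/

/-- A filter on `ω` as a subset of `𝒫(ω)`, which is identified with the Cantor space `2^ω` through
characteristic functions. -/
def Filter.cantorSet (F : Filter ℕ) : Set (ℕ → Bool) :=
  {x | {n | x n = true} ∈ F}

/-! If `F` is the union of compact sets `K j`, a name `τ` for a real cannot dominate. For a stem
`s`, deciding `τ n` below a condition with side `x` uses only finitely many elements of `x`, so by
compactness finitely many values suffice for all `x ∈ K j` (`exists_bound_of_isCompact`).
Diagonalizing over `s` and `j` gives a ground model function that no condition forces `τ` to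
dominate.

If `F` is analytic but not σ-compact, a Hurewicz-type tree construction (`Hurewicz.exists_family`)
gives sets `X f ∈ F` such that every point of `F` has a neighbourhood in which `f n` is bounded. As
`F` is upward closed, this bound is witnessed by a finite subset of each member of `F`
(`Filter.exists_finset_bound`). The generic set thus yields a bound for each `n`, and shrinking the
side into `X f` makes these bounds eventually at least `f`. -/

open Set Topology

namespace MathiasForcing

variable {F : Filter ℕ}

/-- Finite subsets of the side of a condition can be added to its stem. -/
theorem exists_le_subset_stem (hcof : F ≤ Filter.cofinite) (q : MathiasForcing F) (a : Finset ℕ)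
    (ha : ∀ i ∈ a, i ∈ q.side) : ∃ r ≤ q, a ⊆ r.stem := by
  classical
  refine ⟨⟨q.stem ∪ a, q.side ∩ {i | ∀ j ∈ a, j < i}, Filter.inter_mem q.side_mem ?_, ?_⟩,
    ⟨inter_subset_left, ⟨Finset.subset_union_left, ?_⟩, ?_⟩, Finset.subset_union_right⟩
  · refine hcof ?_
    rw [Filter.mem_cofinite]
    refine (Set.finite_Iic (a.sup id)).subset fun i hi => ?_
    simp only [mem_compl_iff, mem_ofPred_eq, not_forall, not_lt] at hi
    obtain ⟨j, hj, hij⟩ := hi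
    exact hij.trans (Finset.le_sup (f := id) hj)
  · rintro i hi j ⟨hj, hj'⟩
    rcases Finset.mem_union.1 hi with hi | hi
    · exact q.stem_lt_side i hi j hj
    · exact hj' i hi
  · intro i hi j hj hjq
    rcases Finset.mem_union.1 hj with hj | hj
    · exact absurd hj hjq
    · exact q.stem_lt_side i hi j (ha j hj)
  · intro i hi hiq
    rcases Finset.mem_union.1 hi with hi | hi
    · exact absurd hi hiq
    · exact ha i hi

/-- Shrink the side of a condition. -/
def restrict (q : MathiasForcing F) (A : Set ℕ) (hA : A ∈ F) : MathiasForcing F where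
  stem := q.stem
  side := q.side ∩ A
  side_mem := Filter.inter_mem q.side_mem hA
  stem_lt_side i hi j hj := q.stem_lt_side i hi j hj.1

theorem restrict_le (q : MathiasForcing F) (A : Set ℕ) (hA : A ∈ F) : q.restrict A hA ≤ q :=
  ⟨inter_subset_left, ⟨subset_rfl, fun _ _ _ h h' => absurd h h'⟩, fun _ h h' => absurd h h'⟩

end MathiasForcing

/-! ### Names for reals defined by least values -/

namespace Forcing

variable {P : Type*} [Preorder P]

theorem mem.mono {n m : ℕ} {τ : Name P} {p q : P} (h : mem n m τ p) (hq : q ≤ p) :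
    mem n m τ q := fun r hr => h r (hr.trans hq)

/-- The name for the function sending `n` to the least `m` such that the generic filter
meets `Q n m`. -/
def leastName (Q : ℕ → ℕ → Set P) : Name P :=
  fun n m => {p | p ∈ Q n m ∧ ∀ m' < m, ∀ q ≤ p, q ∉ Q n m'}

theorem mem_of_mem_name {n m : ℕ} {τ : Name P} {p : P} (h : p ∈ τ n m) : mem n m τ p :=
  fun q hq => ⟨q, le_rfl, p, h, hq⟩

theorem exists_mem_leastName {Q : ℕ → ℕ → Set P} {n : ℕ}
    (hQ : ∀ p, ∃ q ≤ p, ∃ m, q ∈ Q n m) (p : P) : ∃ q ≤ p, ∃ m, q ∈ leastName Q n m := by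
  classical
  have h : ∃ m, ∃ q ≤ p, q ∈ Q n m := by
    obtain ⟨q, hq, m, hm⟩ := hQ p
    exact ⟨m, q, hq, hm⟩
  obtain ⟨q, hq, hm⟩ := Nat.find_spec h
  exact ⟨q, hq, Nat.find h, hm, fun m' hm' r hr hr' =>
    Nat.find_min h hm' ⟨r, hr.trans hq, hr'⟩⟩

/-- If both `m < m'` were values, a common extension would lie in `Q n m` by downward closure, which
the minimality of `m'` forbids. -/
theorem isReal_leastName {Q : ℕ → ℕ → Set P} (hQ : ∀ n p, ∃ q ≤ p, ∃ m, q ∈ Q n m)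
    (hdown : ∀ n m p q, p ∈ Q n m → q ≤ p → q ∈ Q n m) (p : P) : isReal (leastName Q) p := by
  have key : ∀ n m m' q, m < m' → mem n m (leastName Q) q → mem n m' (leastName Q) q → False := by
    intro n m m' q hlt h h'
    obtain ⟨r, hr, s, hs, hrs⟩ := h q le_rfl
    obtain ⟨r', hr', s', hs', hrs'⟩ := h' r hr
    exact hs'.2 m hlt r' hrs' (hdown n m s r' hs.1 (hr'.trans hrs))
  refine ⟨fun n q _ => ?_, fun n m m' q _ h => ?_⟩
  · obtain ⟨r, hr, m, hm⟩ := exists_mem_leastName (hQ n) q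
    exact ⟨r, hr, m, mem_of_mem_name hm⟩
  · rcases lt_or_gt_of_ne m'.2 with hlt | hlt
    · exact key n m m' q hlt h.1 h.2
    · exact key n m' m q hlt h.2 h.1

end Forcing

/-! ### A dominating real from a locally bounded family -/

section Dominating

open Forcing

variable {F : Filter ℕ}

/-- A family of members of `F` indexed by `ℕ → ℕ` whose coordinates are locally bounded near each
member of `F` yields a dominating real. -/
theorem MathiasForcing.existsDominatingReal_of_family (hcof : F ≤ Filter.cofinite)
    (X : (ℕ → ℕ) → Set ℕ) (hX : ∀ f, X f ∈ F)
    (hbdd : ∀ n, ∀ A ∈ F, ∃ k, ∃ a : Finset ℕ, ↑a ⊆ A ∧ ∀ f, k < f n → ¬ ↑a ⊆ X f)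
    (p : MathiasForcing F) : existsDominatingReal p := by
  -- The clause `n ≤ i` puts `a` beyond any given stem once `n` is large; whatever enters the stem
  -- later comes from the side.
  let Q : ℕ → ℕ → Set (MathiasForcing F) := fun n k =>
    {p | ∃ a ⊆ p.stem, (∀ i ∈ a, n ≤ i) ∧ ∀ f, k < f n → ¬ ↑a ⊆ X f}
  have hQ : ∀ n p, ∃ q ≤ p, ∃ m, q ∈ Q n m := by
    intro n p
    have hn : {i | n ≤ i} ∈ F := hcof (by
      rw [Filter.mem_cofinite]
      refine (Set.finite_Iio n).subset fun i hi => ?_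
      simpa using hi)
    obtain ⟨k, a, ha, hk⟩ := hbdd n _ (Filter.inter_mem p.side_mem hn)
    obtain ⟨r, hr, har⟩ := exists_le_subset_stem hcof p a fun i hi => (ha hi).1
    exact ⟨r, hr, k, a, har, fun i hi => (ha hi).2, hk⟩
  have hdown : ∀ n m p q, p ∈ Q n m → q ≤ p → q ∈ Q n m := by
    rintro n m p q ⟨a, ha, h⟩ hq
    exact ⟨a, ha.trans hq.2.1.1, h⟩
  refine fun q _ => ⟨q, le_rfl, leastName Q, isReal_leastName hQ hdown q, fun g q' _ => ?_⟩
  refine ⟨q'.restrict _ (hX fun n => g n + 1), q'.restrict_le _ _, q'.stem.sup id + 1, ?_⟩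
  rintro ⟨n, hn⟩ r hr
  obtain ⟨r', hr', m, hm⟩ := exists_mem_leastName (hQ n) r
  refine ⟨r', hr', ⟨m, ?_⟩, mem_of_mem_name hm⟩
  by_contra hlt
  replace hlt : m < g n := not_le.1 hlt
  obtain ⟨a, ha, han, hak⟩ := hm.1
  refine hak (fun n => g n + 1) (by omega) fun i hi => ?_
  refine ((hr'.trans hr).2.2 i (ha hi) fun hi' => ?_).2
  have h1 : i ≤ q'.stem.sup id := Finset.le_sup (f := id) hi'
  have h2 := han i hi
  omega

end Dominating

/-! ### σ-compact filters add no dominating real -/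

section SigmaCompact

open Forcing

variable {F : Filter ℕ}

theorem isOpen_setOf_forall_mem_finset_eq_true (a : Finset ℕ) :
    IsOpen {x : ℕ → Bool | ∀ i ∈ a, x i = true} := by
  have : {x : ℕ → Bool | ∀ i ∈ a, x i = true} = ⋂ i ∈ a, (fun x : ℕ → Bool => x i) ⁻¹' {true} := by
    ext x; simp
  rw [this]
  exact isOpen_biInter_finset fun i _ => (isOpen_discrete _).preimage (continuous_apply i)

/-- Given a name of a real, a stem `s` and a compact subset of `F`, finitely many values suffice
to decide the real compatibly with all conditions with stem `s` and side in the compact set. -/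
theorem MathiasForcing.exists_bound_of_isCompact {τ : Name (MathiasForcing F)}
    {p : MathiasForcing F} (hτ : isReal τ p) {K : Set (ℕ → Bool)} (hK : IsCompact K)
    (hKF : K ⊆ F.cantorSet) (s : Finset ℕ) (n : ℕ) :
    ∃ b, ∀ q ≤ p, q.stem = s → ∀ x ∈ K, ∃ r ≤ p, ∃ v < b, IsEndExtension r.stem s ∧
      (∀ i ∈ r.stem, i ∉ s → x i = true) ∧ mem n v τ r := by
  classical
  by_cases hs : ∃ q ≤ p, q.stem = s
  swap
  · exact ⟨0, fun q hq hqs => absurd ⟨q, hq, hqs⟩ hs⟩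
  obtain ⟨q, hq, rfl⟩ := hs
  let ι := {rv : MathiasForcing F × ℕ //
    rv.1 ≤ p ∧ IsEndExtension rv.1.stem q.stem ∧ mem n rv.2 τ rv.1}
  obtain ⟨t, ht⟩ := hK.elim_finite_subcover
    (fun j : ι => {x : ℕ → Bool | ∀ i ∈ j.1.1.stem \ q.stem, x i = true})
    (fun j => isOpen_setOf_forall_mem_finset_eq_true _) (by
      -- Shrink the side of `q` into `x` and decide `τ n`: the resulting stem adds only finitely
      -- many elements of `x`, so it serves a neighbourhood of `x`.
      intro x hx
      obtain ⟨r, hr, v, hv⟩ := hτ.1 n (q.restrict _ (hKF hx)) ((q.restrict_le _ _).trans hq)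
      refine mem_iUnion.2 ⟨⟨(r, v), hr.trans ((q.restrict_le _ _).trans hq), hr.2.1, hv⟩, ?_⟩
      intro i hi
      exact (hr.2.2 i (Finset.mem_sdiff.1 hi).1 (Finset.mem_sdiff.1 hi).2).2)
  refine ⟨t.sup (fun j => j.1.2) + 1, fun _ _ _ x hx => ?_⟩
  obtain ⟨j, hj, hxj⟩ := mem_iUnion₂.1 (ht hx)
  exact ⟨j.1.1, j.2.1, j.1.2, Nat.lt_succ_of_le (Finset.le_sup (f := fun j : ι => j.1.2) hj),
    j.2.2.1, fun i hi his => hxj i (Finset.mem_sdiff.2 ⟨hi, his⟩), j.2.2.2⟩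

theorem MathiasForcing.addsNoDominatingReal_of_isSigmaCompact
    (hF : IsSigmaCompact F.cantorSet) : AddsNoDominatingReal (MathiasForcing F) := by
  classical
  obtain ⟨K, hK, hKF⟩ := hF
  intro p₀ p₁ _ hex
  obtain ⟨p, _, τ, hτ, hdom⟩ := hex p₁ le_rfl
  choose b hb using fun (s : Finset ℕ) (n j : ℕ) =>
    exists_bound_of_isCompact hτ (hK j) ((subset_iUnion K j).trans hKF.subset) s n
  -- Each pair of a stem and an index `j` is taken into account from some `n` on.
  let g : ℕ → ℕ := fun n =>
    (Finset.range n).powerset.sup fun s => (Finset.range n).sup fun j => b s n j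
  obtain ⟨q, hq, N, hN⟩ := hdom g p le_rfl
  have hA : (fun i => decide (i ∈ q.side)) ∈ F.cantorSet := by
    simpa [Filter.cantorSet] using q.side_mem
  rw [← hKF] at hA
  obtain ⟨j, hj⟩ := mem_iUnion.1 hA
  obtain ⟨n, hNn, hjn, hsn⟩ : ∃ n, N ≤ n ∧ j < n ∧ q.stem.sup id < n :=
    ⟨N + j + q.stem.sup id + 1, by omega, by omega, by omega⟩
  obtain ⟨r, hr, v, hv, hend, hside, hmem⟩ := hb q.stem n j q hq rfl _ hj
  have hvg : v < g n := by
    refine hv.trans_le ?_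
    have h1 : q.stem ∈ (Finset.range n).powerset := Finset.mem_powerset.2 fun i hi =>
      Finset.mem_range.2 ((Finset.le_sup (f := id) hi).trans_lt hsn)
    exact (Finset.le_sup (f := fun j => b q.stem n j) (Finset.mem_range.2 hjn)).trans
      (Finset.le_sup (f := fun s => (Finset.range n).sup fun j => b s n j) h1)
  -- `r` need not lie below `q`, but the elements it adds to the stem lie in `q.side`, so the two
  -- are compatible.
  have hr' : r.restrict q.side q.side_mem ≤ q :=
    ⟨inter_subset_right, hend, fun i hi his => by simpa using hside i hi his⟩
  obtain ⟨r', hr'', ⟨m, hm⟩, hmem'⟩ := hN ⟨n, hNn⟩ _ hr'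
  exact hτ.2 n v ⟨m, fun h => by subst h; exact absurd hvg (not_lt.2 hm)⟩ r'
    (hr''.trans (hr'.trans hq)) ⟨hmem.mono (hr''.trans (r.restrict_le _ _)), hmem'⟩

end SigmaCompact

/-! ### A Hurewicz scheme in an analytic set that is not σ-compact -/

namespace Hurewicz

open PiNat

variable {φ : (ℕ → ℕ) → ℕ → Bool} {S : Set (ℕ → Bool)}

/-- The points without neighbourhoods whose images lie in a σ-compact subset of `S`. -/
def kernel (φ : (ℕ → ℕ) → ℕ → Bool) (S : Set (ℕ → Bool)) : Set (ℕ → ℕ) :=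
  {x | ∀ U, IsOpen U → x ∈ U → ¬ ∃ T ⊆ S, IsSigmaCompact T ∧ φ '' U ⊆ T}

/-- By the Lindelöf property, countably many of the removed open sets cover the complement of the
kernel. -/
theorem exists_isSigmaCompact_image_compl_kernel :
    ∃ T ⊆ S, IsSigmaCompact T ∧ φ '' (kernel φ S)ᶜ ⊆ T := by
  let 𝒰 : Set (Set (ℕ → ℕ)) := {U | IsOpen U ∧ ∃ T ⊆ S, IsSigmaCompact T ∧ φ '' U ⊆ T}
  obtain ⟨𝒱, hc, hsub, hV⟩ := TopologicalSpace.isOpen_sUnion_countable 𝒰 fun U hU => hU.1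
  choose! T hTS hT hφT using fun U (hU : U ∈ 𝒰) => hU.2
  refine ⟨⋃ U ∈ 𝒱, T U, iUnion₂_subset fun U hU => hTS U (hsub hU), ?_, ?_⟩
  · exact isSigmaCompact_biUnion hc fun U hU => hT U (hsub hU)
  · rintro _ ⟨x, hx, rfl⟩
    simp only [kernel, mem_compl_iff, mem_ofPred_eq, not_forall, not_not] at hx
    obtain ⟨U, hU, hxU, hU'⟩ := hx
    have : x ∈ ⋃₀ 𝒱 := hV ▸ mem_sUnion_of_mem hxU ⟨hU, hU'⟩
    obtain ⟨V, hV, hxV⟩ := this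
    exact mem_biUnion hV (hφT V (hsub hV) (mem_image_of_mem φ hxV))

theorem kernel_nonempty (hφ : range φ = S) (hS : ¬ IsSigmaCompact S) :
    (kernel φ S).Nonempty := by
  by_contra h
  obtain ⟨T, hTS, hT, h'⟩ := exists_isSigmaCompact_image_compl_kernel (φ := φ) (S := S)
  rw [not_nonempty_iff_eq_empty.1 h, compl_empty, image_univ, hφ] at h'
  exact hS (subset_antisymm hTS h' ▸ hT)

/-- Otherwise this closure is a compact subset of `S`; together with the σ-compact set covering the
image of the complement of the kernel, it covers `φ '' U`. -/
theorem exists_mem_closure_notMem {x : ℕ → ℕ} (hx : x ∈ kernel φ S)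
    {U : Set (ℕ → ℕ)} (hU : IsOpen U) (hxU : x ∈ U) :
    ∃ z ∈ closure (φ '' (U ∩ kernel φ S)), z ∉ S := by
  by_contra! h
  obtain ⟨T, hTS, hT, hT'⟩ := exists_isSigmaCompact_image_compl_kernel (φ := φ) (S := S)
  refine hx U hU hxU ⟨closure (φ '' (U ∩ kernel φ S)) ∪ T, union_subset h hTS, ?_, ?_⟩
  · rw [union_eq_iUnion]
    exact isSigmaCompact_iUnion _ fun b => by
      cases b
      · exact hT
      · exact isClosed_closure.isCompact.isSigmaCompact
  · rintro _ ⟨y, hy, rfl⟩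
    by_cases hyk : y ∈ kernel φ S
    · exact Or.inl (subset_closure ⟨y, ⟨hy, hyk⟩, rfl⟩)
    · exact Or.inr (hT' ⟨y, hyk, rfl⟩)

/-- A node of the Hurewicz scheme: a cylinder around a point of the kernel. -/
structure Node (φ : (ℕ → ℕ) → ℕ → Bool) (S : Set (ℕ → Bool)) where
  center : ℕ → ℕ
  center_mem : center ∈ kernel φ S
  length : ℕ

/-- The images of the children converge to a point outside `S`, so each point of `S` has a
neighbourhood missing the images of all but finitely many children. -/
theorem Node.exists_limit_children (hφ : Continuous φ) (ν : Node φ S) :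
    ∃ z ∉ S, ∃ next : ℕ → Node φ S, ∀ k, ν.length < (next k).length ∧
      (next k).center ∈ cylinder ν.center ν.length ∧
      ∀ y ∈ cylinder (next k).center (next k).length, φ y ∈ cylinder z k := by
  obtain ⟨z, hz, hzS⟩ := exists_mem_closure_notMem ν.center_mem
    (isOpen_cylinder (fun _ => ℕ) ν.center ν.length) (self_mem_cylinder _ _)
  have h : ∀ k, ∃ μ : Node φ S, ν.length < μ.length ∧
      μ.center ∈ cylinder ν.center ν.length ∧
      ∀ y ∈ cylinder μ.center μ.length, φ y ∈ cylinder z k := by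
    intro k
    obtain ⟨_, hck, c, ⟨hc, hcker⟩, rfl⟩ := mem_closure_iff.1 hz _
      (isOpen_cylinder (fun _ => Bool) z k) (self_mem_cylinder _ _)
    have hopen := (isOpen_cylinder (fun _ => Bool) z k).preimage hφ
    obtain ⟨_, ⟨x, l, rfl⟩, hcx, hsub⟩ :=
      (isTopologicalBasis_cylinders (fun _ => ℕ)).exists_subset_of_mem_open
        (show c ∈ φ ⁻¹' cylinder z k from hck) hopen
    refine ⟨⟨c, hcker, max l (ν.length + 1)⟩, by simp, hc, fun y hy => hsub ?_⟩
    rw [← mem_cylinder_iff_eq.1 hcx]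
    exact cylinder_anti c (le_max_left _ _) hy
  choose next hnext using h
  exact ⟨z, hzS, next, hnext⟩

section Scheme

variable (next : Node φ S → ℕ → Node φ S)

/-- The node reached from `ν` along the first `n` values of `f`. -/
def descend : Node φ S → (ℕ → ℕ) → ℕ → Node φ S
  | ν, _, 0 => ν
  | ν, f, n + 1 => descend (next ν (f 0)) (fun i => f (i + 1)) n

/-- The point determined by the branch `f` starting from `ν`. -/
def branch (ν : Node φ S) (f : ℕ → ℕ) : ℕ → ℕ :=
  fun i => (descend next ν f (i + 1)).center i

variable {next}

/-- Ensures that coordinate `i` no longer changes after the node at depth `i + 1`, so `branch` lies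
in every cylinder along its path. -/
theorem le_length_descend (hlen : ∀ ν k, ν.length < (next ν k).length) (n : ℕ) (ν : Node φ S)
    (f : ℕ → ℕ) : n + ν.length ≤ (descend next ν f n).length := by
  induction n generalizing ν f with
  | zero => simp [descend]
  | succ n ih =>
    have h1 := ih (next ν (f 0)) fun i => f (i + 1)
    have h2 := hlen ν (f 0)
    simp only [descend]
    omega

theorem center_descend_mem_cylinder (hlen : ∀ ν k, ν.length < (next ν k).length)
    (hcen : ∀ ν k, (next ν k).center ∈ cylinder ν.center ν.length) (n : ℕ) (ν : Node φ S)
    (f : ℕ → ℕ) : (descend next ν f n).center ∈ cylinder ν.center ν.length := by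
  induction n generalizing ν f with
  | zero => exact self_mem_cylinder _ _
  | succ n ih =>
    have h := cylinder_anti _ (hlen ν (f 0)).le (ih (next ν (f 0)) fun i => f (i + 1))
    rwa [mem_cylinder_iff_eq.1 (hcen ν (f 0))] at h

theorem center_descend_succ_mem_cylinder
    (hcen : ∀ ν k, (next ν k).center ∈ cylinder ν.center ν.length) (n : ℕ) (ν : Node φ S)
    (f : ℕ → ℕ) : (descend next ν f (n + 1)).center ∈
      cylinder (descend next ν f n).center (descend next ν f n).length := by
  induction n generalizing ν f with
  | zero => exact hcen ν (f 0)
  | succ n ih => exact ih (next ν (f 0)) fun i => f (i + 1)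

theorem branch_mem_cylinder (hlen : ∀ ν k, ν.length < (next ν k).length)
    (hcen : ∀ ν k, (next ν k).center ∈ cylinder ν.center ν.length) (ν : Node φ S)
    (f : ℕ → ℕ) : branch next ν f ∈ cylinder ν.center ν.length :=
  mem_cylinder_iff.2 fun i hi =>
    mem_cylinder_iff.1 (center_descend_mem_cylinder hlen hcen (i + 1) ν f) i hi

/-- Self-similarity of the tree: coordinate `n + 1` at a node becomes coordinate `n` at a child. -/
theorem branch_next (hlen : ∀ ν k, ν.length < (next ν k).length)
    (hcen : ∀ ν k, (next ν k).center ∈ cylinder ν.center ν.length) (ν : Node φ S)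
    (f : ℕ → ℕ) : branch next (next ν (f 0)) (fun i => f (i + 1)) = branch next ν f := by
  funext i
  refine mem_cylinder_iff.1 (center_descend_succ_mem_cylinder hcen (i + 1) ν f) i ?_
  have := le_length_descend hlen (i + 1) ν f
  omega

/-- Near each point of `S`, the coordinates of the branches are bounded. -/
theorem exists_bound_of_mem_cylinder (hlen : ∀ ν k, ν.length < (next ν k).length)
    (hcen : ∀ ν k, (next ν k).center ∈ cylinder ν.center ν.length) {z : Node φ S → ℕ → Bool}
    (hzS : ∀ ν, z ν ∉ S)
    (hz : ∀ ν k, ∀ y ∈ cylinder (next ν k).center (next ν k).length, φ y ∈ cylinder (z ν) k)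
    {x : ℕ → Bool} (hx : x ∈ S) (n : ℕ) (ν : Node φ S) :
    ∃ k i, ∀ f, k < f n → φ (branch next ν f) ∉ cylinder x i := by
  have hbranch : ∀ ν f, φ (branch next ν f) ∈ cylinder (z ν) (f 0) := fun ν f =>
    branch_next hlen hcen ν f ▸ hz ν (f 0) _ (branch_mem_cylinder hlen hcen _ _)
  have hsep : ∀ ν, ∃ d, ∀ f, d < f 0 → φ (branch next ν f) ∉ cylinder x (d + 1) := by
    intro ν
    obtain ⟨d, hd⟩ := Function.ne_iff.1 (ne_of_mem_of_not_mem hx (hzS ν))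
    refine ⟨d, fun f hf h => hd ?_⟩
    rw [← mem_cylinder_iff.1 h d d.lt_succ_self, mem_cylinder_iff.1 (hbranch ν f) d hf]
  induction n generalizing ν with
  | zero =>
    obtain ⟨d, hd⟩ := hsep ν
    exact ⟨d, d + 1, hd⟩
  | succ n ih =>
    obtain ⟨d, hd⟩ := hsep ν
    choose k i h using fun j => ih (next ν j)
    refine ⟨(Finset.range (d + 1)).sup k, max (d + 1) ((Finset.range (d + 1)).sup i),
      fun f hf hmem => ?_⟩
    -- Large values of `f 0` are kept away from `x` by the limit point; only the finitely many
    -- children up to `d` need the induction hypothesis.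
    by_cases hfd : d < f 0
    · exact hd f hfd (cylinder_anti _ (le_max_left _ _) hmem)
    · have hmem0 : f 0 ∈ Finset.range (d + 1) := Finset.mem_range.2 (by omega)
      refine h (f 0) (fun i => f (i + 1)) ((Finset.le_sup hmem0).trans_lt hf) ?_
      rw [branch_next hlen hcen]
      exact cylinder_anti _ ((Finset.le_sup hmem0).trans (le_max_right _ _)) hmem

end Scheme

/-- An analytic subset of the Cantor space which is not σ-compact contains a family indexed by
`ℕ → ℕ` whose coordinates are locally bounded near each point of the set. -/
theorem exists_family (hS : MeasureTheory.AnalyticSet S) (hS' : ¬ IsSigmaCompact S) :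
    ∃ X : (ℕ → ℕ) → ℕ → Bool, (∀ f, X f ∈ S) ∧
      ∀ n, ∀ x ∈ S, ∃ k i, ∀ f, k < f n → X f ∉ cylinder x i := by
  rw [MeasureTheory.AnalyticSet] at hS
  rcases hS with rfl | ⟨φ, hφ, hφS⟩
  · exact absurd isSigmaCompact_empty hS'
  choose z hzS next hnext using fun ν : Node φ S => ν.exists_limit_children hφ
  obtain ⟨c, hc⟩ := kernel_nonempty hφS hS'
  exact ⟨fun f => φ (branch next ⟨c, hc, 0⟩ f), fun f => hφS.subset (mem_range_self _), fun n x hx =>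
    exists_bound_of_mem_cylinder (fun ν k => (hnext ν k).1) (fun ν k => (hnext ν k).2.1) hzS
      (fun ν k => (hnext ν k).2.2) hx n _⟩

end Hurewicz

/-! ### Finite witnesses and the equivalence -/

section Main

open PiNat

variable {F : Filter ℕ}

/-- By compactness of the set of supersets of `A`, bounds near each member of `F` can be chosen
uniformly near all supersets of a member `A` of `F`. -/
theorem Filter.exists_finset_bound {X : (ℕ → ℕ) → ℕ → Bool} {n : ℕ}
    (hX : ∀ x ∈ F.cantorSet, ∃ k i, ∀ f, k < f n → X f ∉ cylinder x i) {A : Set ℕ}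
    (hA : A ∈ F) :
    ∃ k, ∃ a : Finset ℕ, ↑a ⊆ A ∧ ∀ f, k < f n → ¬ ↑a ⊆ {i | X f i = true} := by
  classical
  let C : Set (ℕ → Bool) := {x | ∀ i ∈ A, x i = true}
  have hC : IsCompact C := by
    have : C = ⋂ i ∈ A, (fun x : ℕ → Bool => x i) ⁻¹' {true} := by
      ext x; simp [C]
    rw [this]
    exact (isClosed_biInter fun i _ =>
      (isClosed_discrete _).preimage (continuous_apply i)).isCompact
  have hCF : ∀ x ∈ C, x ∈ F.cantorSet := fun x hx => Filter.mem_of_superset hA hx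
  choose! k i h using hX
  obtain ⟨t, htC, ht⟩ := hC.elim_nhds_subcover (fun x => cylinder x (i x)) fun x _ =>
    (isOpen_cylinder (fun _ => Bool) x (i x)).mem_nhds (self_mem_cylinder _ _)
  refine ⟨t.sup k, (Finset.range (t.sup i)).filter (· ∈ A), fun j hj => by simp_all,
    fun f hf ha => ?_⟩
  -- `y` is the union of `A` and `X f`. Since `a ⊆ X f`, it agrees with `X f` below `t.sup i`, so
  -- the two lie in the same cylinder of the finite cover.
  let y : ℕ → Bool := fun j => if j ∈ A then true else X f j
  have hy : y ∈ C := fun j hj => by simp [y, hj]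
  obtain ⟨x, hxt, hyx⟩ := mem_iUnion₂.1 (ht hy)
  refine h x (hCF x (htC x hxt)) f ((Finset.le_sup hxt).trans_lt hf)
    (mem_cylinder_iff.2 fun j hj => ?_)
  rw [← mem_cylinder_iff.1 hyx j hj]
  by_cases hjA : j ∈ A
  · have : X f j = true := ha (by simpa [hjA] using ⟨x, hxt, hj⟩)
    simp [y, hjA, this]
  · simp [y, hjA]

end Main

theorem corollary1p2 (F : Filter ℕ) [F.NeBot] (hcof : F ≤ Filter.cofinite)
    (hF : MeasureTheory.AnalyticSet F.cantorSet) :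
    Forcing.AddsNoDominatingReal (MathiasForcing F) ↔ IsSigmaCompact F.cantorSet := by
  refine ⟨fun h => ?_, MathiasForcing.addsNoDominatingReal_of_isSigmaCompact⟩
  by_contra hS
  obtain ⟨X, hXF, hX⟩ := Hurewicz.exists_family hF hS
  let p : MathiasForcing F := ⟨∅, Set.univ, Filter.univ_mem, by simp⟩
  exact h p p le_rfl (MathiasForcing.existsDominatingReal_of_family hcof
    (fun f => {i | X f i = true}) hXF (fun n A hA => Filter.exists_finset_bound (hX n) hA) p)
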